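/- Let $\overline{\mathbb Q}$ be an algebraic closure of $\mathbb Q$, and let $h:\overline{\mathbb Q}^\times\to[0,\infty)$ be the absolute logarithmic Weil height. Let $K_1,\dots,K_N$ be subfields of $\overline{\mathbb Q}$ (not necessarily of finite degree over $\mathbb Q$) such that for each pair of indices $n_1\neq n_2$ at least one of the extensions $K_{n_1}/(K_{n_1}\cap K_{n_2})$ and $K_{n_2}/(K_{n_1}\cap K_{n_2})$ is a (possibly infinite) Galois extension. Let $\alpha\in\overline{\mathbb Q}^\times$. Assume that for every $\varepsilon>0$ there exist an integer $m\neq 0$ and elements $\beta_n\in K_n^\times$ for $n=1,\dots,N$ such that $$h\bigl(\alpha^m\beta_1^{-1}\beta_2^{-1}\cdots\beta_N^{-1}\bigr)<\varepsilon|m|.$$ Then there exists an integer $q\neq 0$ such that $\alpha^q\in K_1^\times K_2^\times\cdots K_N^\times$, that is, $\alpha^q=\gamma_1\gamma_2\cdots\gamma_N$ for some $\gamma_n\in K_n^\times$, $n=1,\dots,N$. -/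

import Mathlib

/-! Pass to the rational vector space V obtained from the multiplicative group by killing torsion
and adjoining roots (`DivisibleHull`). The height becomes a Galois-invariant seminorm, and by
Kronecker a norm. The image of K_n^×, after inverting integers, is the space V_n of vectors fixed by
H_n, the automorphisms over K_n. The hypothesis says that α lies in the closure of ∑ V_n; the claim
is that this sum is closed.

Since orbits are finite, averaging over them gives a projection P_n onto V_n which does not increase
the seminorm. If K_i is Galois over K_i ∩ K_j, then H_j normalizes H_i, and P_i, P_j commute
(`commute_invariantsProjection_of_le_normalizer`). Hence T = ∏ (1 - P_n) vanishes on ∑ V_n, has norm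
at most 2^N, and v - Tv always lies in ∑ V_n. For v in the closure Tv has norm zero, so v itself is
in ∑ V_n. Clearing denominators and torsion gives q. -/

open NumberField Height Module IntermediateField

/-! ### Heights under extension of number fields -/

section Extension

variable {K L : Type*} [Field K] [NumberField K] [Field L] [NumberField L]

/-- A product over infinite places, with multiplicities, is a product over complex embeddings. -/
lemma prod_infinitePlace_pow_mult {M : Type*} [CommMonoid M] (f : InfinitePlace K → M) :
    ∏ v : InfinitePlace K, f v ^ v.mult = ∏ φ : K →+* ℂ, f (.mk φ) := by
  classical
  rw [← Finset.prod_fiberwise_of_maps_to (s := Finset.univ) (t := Finset.univ)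
    (g := fun φ : K →+* ℂ ↦ InfinitePlace.mk φ) (fun _ _ ↦ Finset.mem_univ _)]
  refine Finset.prod_congr rfl fun v _ ↦ ?_
  rw [← InfinitePlace.card_filter_mk_eq v]
  refine (Finset.prod_eq_pow_card fun φ hφ ↦ ?_).symm
  rw [(Finset.mem_filter.mp hφ).2]

variable [Algebra K L]

/-- Every complex embedding of `K` has `[L : K]` extensions to `L`. -/
lemma card_filter_comp_algebraMap_eq (φ : K →+* ℂ) [DecidableEq (K →+* ℂ)] :
    (Finset.univ.filter fun ψ : L →+* ℂ ↦ ψ.comp (algebraMap K L) = φ).card = finrank K L := by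
  let : Algebra K ℂ := φ.toAlgebra
  rw [← AlgHom.card K L ℂ, ← Fintype.card_subtype]
  exact Fintype.card_congr
    { toFun := fun ψ ↦ { ψ.1 with commutes' := fun x ↦ RingHom.congr_fun ψ.2 x }
      invFun := fun ψ ↦ ⟨ψ.toRingHom, RingHom.ext fun x ↦ ψ.commutes x⟩
      left_inv := fun _ ↦ rfl
      right_inv := fun _ ↦ rfl }

lemma prod_comp_algebraMap {M : Type*} [CommMonoid M] (f : (K →+* ℂ) → M) :
    ∏ ψ : L →+* ℂ, f (ψ.comp (algebraMap K L)) = (∏ φ : K →+* ℂ, f φ) ^ finrank K L := by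
  classical
  rw [← Finset.prod_fiberwise_of_maps_to (s := Finset.univ) (t := Finset.univ)
    (g := fun ψ : L →+* ℂ ↦ ψ.comp (algebraMap K L)) (fun _ _ ↦ Finset.mem_univ _),
    ← Finset.prod_pow]
  refine Finset.prod_congr rfl fun φ _ ↦ ?_
  rw [← card_filter_comp_algebraMap_eq (L := L) φ]
  refine Finset.prod_eq_pow_card fun ψ hψ ↦ ?_
  rw [(Finset.mem_filter.mp hψ).2]

/-- The finite part of the height is the inverse norm of the ideal spanned by the tuple, and
extending an ideal raises its norm to the power of the degree. No analysis of places above a given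
place is needed. -/
lemma finprod_finitePlace_algebraMap {ι : Type*} [Finite ι] {x : ι → 𝓞 K} (hx : x ≠ 0) :
    ∏ᶠ w : FinitePlace L, ⨆ i, w (algebraMap K L (x i)) =
      (∏ᶠ v : FinitePlace K, ⨆ i, v (x i)) ^ finrank K L := by
  have hx' : (fun i ↦ algebraMap (𝓞 K) (𝓞 L) (x i)) ≠ 0 := by
    contrapose! hx
    ext i : 1
    exact (map_eq_zero_iff _ (FaithfulSMul.algebraMap_injective (𝓞 K) (𝓞 L))).mp (congrFun hx i)
  have hL := absNorm_mul_finprod_finitePlace_eq_one hx'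
  have hK := absNorm_mul_finprod_finitePlace_eq_one hx
  have hspan : Ideal.span (Set.range fun i ↦ algebraMap (𝓞 K) (𝓞 L) (x i)) =
      (Ideal.span (Set.range x)).map (algebraMap (𝓞 K) (𝓞 L)) := by
    rw [Ideal.map_span, ← Set.range_comp]; rfl
  rw [hspan, Ideal.absNorm_algebraMap] at hL
  have hfr : finrank (𝓞 K) (𝓞 L) = finrank K L := (IsFractionRing.finrank_eq (𝓞 K) K (𝓞 L) L).symm
  rw [hfr] at hL
  have h1 := congrArg (· ^ finrank K L) hK
  simp only [mul_pow, one_pow] at h1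
  push_cast at hL
  have hne : ((Ideal.span (Set.range x)).absNorm : ℝ) ^ finrank K L ≠ 0 := by
    intro h
    rw [h, zero_mul] at h1
    exact zero_ne_one h1
  exact mul_left_cancel₀ hne (hL.trans h1.symm)

/-- The height of an integral tuple in an extension field. -/
lemma mulHeight_algebraMap_integer {ι : Type*} [Finite ι] {x : ι → 𝓞 K} (hx : x ≠ 0) :
    mulHeight (fun i ↦ algebraMap K L (x i)) =
      mulHeight (fun i ↦ (x i : K)) ^ finrank K L := by
  have h0 : (fun i ↦ (x i : K)) ≠ 0 := by
    contrapose! hx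
    ext i
    simpa using congrFun hx i
  have h1 : (fun i ↦ algebraMap K L (x i)) ≠ 0 := by
    contrapose! h0
    ext i
    exact (map_eq_zero _).mp (congrFun h0 i)
  rw [NumberField.mulHeight_eq h0, NumberField.mulHeight_eq h1, finprod_finitePlace_algebraMap hx,
    mul_pow, prod_infinitePlace_pow_mult (fun v : InfinitePlace K ↦ ⨆ i, v (x i : K)),
    prod_infinitePlace_pow_mult (fun w : InfinitePlace L ↦ ⨆ i, w (algebraMap K L (x i))),
    ← prod_comp_algebraMap]
  rfl

/-- The height of an element of a number field in an extension field. -/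
lemma mulHeight₁_algebraMap (x : K) :
    mulHeight₁ (algebraMap K L x) = mulHeight₁ x ^ finrank K L := by
  obtain ⟨a, b, hb, rfl⟩ := IsFractionRing.div_surjective (A := 𝓞 K) x
  have hb0 : b ≠ 0 := nonZeroDivisors.ne_zero hb
  rw [map_div₀, mulHeight₁_div_eq_mulHeight, mulHeight₁_div_eq_mulHeight]
  have hx : ![a, b] ≠ 0 := fun h ↦ hb0 (by simpa using congrFun h 1)
  convert mulHeight_algebraMap_integer (L := L) hx using 2
  · ext i; fin_cases i <;> rfl
  · congr 1; ext i; fin_cases i <;> rfl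

end Extension

/-! ### The absolute height -/

section Absolute

variable {F : Type*} [Field F] [CharZero F]

/-- The absolute height is defined through the field generated by the element. Being computable in
any number field, it inherits the properties of the relative height. -/
lemma absLogHeight₁_ringHom {K : Type*} [Field K] [NumberField K] (φ : K →+* F) (x : K) :
    absLogHeight₁ (φ x) = logHeight₁ x / finrank ℚ K := by
  have hx : IsIntegral ℚ (φ x) := (Algebra.IsIntegral.isIntegral (R := ℚ) x).map φ.toRatAlgHom
  have : FiniteDimensional ℚ ℚ⟮φ x⟯ := IntermediateField.adjoin.finiteDimensional hx
  have : NumberField ℚ⟮φ x⟯ := {}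
  have hle : ℚ⟮φ x⟯ ≤ φ.toRatAlgHom.fieldRange := by
    rw [IntermediateField.adjoin_simple_le_iff]
    exact ⟨x, rfl⟩
  let e := AlgEquiv.ofInjectiveField φ.toRatAlgHom
  let ψ : ℚ⟮φ x⟯ →ₐ[ℚ] K := e.symm.toAlgHom.comp (IntermediateField.inclusion hle)
  let : Algebra ℚ⟮φ x⟯ K := ψ.toRingHom.toAlgebra
  have hψ : algebraMap ℚ⟮φ x⟯ K (IntermediateField.AdjoinSimple.gen ℚ (φ x)) = x := by
    change e.symm _ = x
    rw [AlgEquiv.symm_apply_eq]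
    rfl
  have h1 := mulHeight₁_algebraMap (L := K) (IntermediateField.AdjoinSimple.gen ℚ (φ x))
  rw [hψ] at h1
  have hfr : finrank ℚ ℚ⟮φ x⟯ * finrank ℚ⟮φ x⟯ K = finrank ℚ K := finrank_mul_finrank _ _ _
  have hpos : (0 : ℝ) < finrank ℚ⟮φ x⟯ K := by
    have := finrank_pos (R := ℚ) (M := K)
    rw [← hfr] at this
    exact_mod_cast Nat.pos_of_mul_pos_left this
  have hpos' : (0 : ℝ) < finrank ℚ ℚ⟮φ x⟯ := by exact_mod_cast finrank_pos
  rw [absLogHeight₁, absMulHeight₁, dif_pos hx, Real.log_rpow (by positivity),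
    logHeight₁_eq_log_mulHeight₁, h1, Real.log_pow, ← hfr]
  push_cast
  field_simp

variable [Algebra.IsAlgebraic ℚ F]

lemma exists_numberField_ringHom (s : Finset F) :
    ∃ (E : IntermediateField ℚ F), NumberField E ∧ ∀ x ∈ s, x ∈ E := by
  refine ⟨IntermediateField.adjoin ℚ s, ?_, fun x hx ↦ IntermediateField.subset_adjoin _ _ hx⟩
  have := IntermediateField.finiteDimensional_adjoin (K := ℚ) (S := (s : Set F))
    fun x _ ↦ Algebra.IsIntegral.isIntegral x
  exact {}

lemma absLogHeight₁_mul_le (x y : F) :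
    absLogHeight₁ (x * y) ≤ absLogHeight₁ x + absLogHeight₁ y := by
  classical
  obtain ⟨E, hE, h⟩ := exists_numberField_ringHom {x, y}
  lift x to E using h x (by simp)
  lift y to E using h y (by simp)
  have key := absLogHeight₁_ringHom (F := F) E.val.toRingHom
  have hx := key x
  have hy := key y
  have hxy := key (x * y)
  simp only [map_mul] at hxy
  change absLogHeight₁ (x : F) = _ at hx
  change absLogHeight₁ (y : F) = _ at hy
  change absLogHeight₁ ((x : F) * y) = _ at hxy
  rw [hx, hy, hxy, ← add_div]
  gcongr
  exact logHeight₁_mul_le x y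

lemma absLogHeight₁_zpow (x : F) (n : ℤ) :
    absLogHeight₁ (x ^ n) = |(n : ℝ)| * absLogHeight₁ x := by
  obtain ⟨E, hE, h⟩ := exists_numberField_ringHom {x}
  lift x to E using h x (by simp)
  have key := absLogHeight₁_ringHom (F := F) E.val.toRingHom
  have hx := key x
  have hn := key (x ^ n)
  rw [map_zpow₀] at hn
  change absLogHeight₁ (x : F) = _ at hx
  change absLogHeight₁ ((x : F) ^ n) = _ at hn
  rw [hx, hn, logHeight₁_zpow, Nat.cast_natAbs, Int.cast_abs, mul_div_assoc]

lemma absLogHeight₁_map (σ : F →+* F) (x : F) : absLogHeight₁ (σ x) = absLogHeight₁ x := by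
  obtain ⟨E, hE, h⟩ := exists_numberField_ringHom {x}
  lift x to E using h x (by simp)
  exact (absLogHeight₁_ringHom (σ.comp E.val.toRingHom) x).trans
    (absLogHeight₁_ringHom E.val.toRingHom x).symm

/-- Kronecker's theorem: a nonzero algebraic number of height zero is a root of unity. -/
lemma exists_pow_eq_one_of_absLogHeight₁_eq_zero {x : F} (hx : x ≠ 0)
    (h0 : absLogHeight₁ x = 0) : ∃ n : ℕ, n ≠ 0 ∧ x ^ n = 1 := by
  obtain ⟨E, hE, h⟩ := exists_numberField_ringHom {x}
  lift x to E using h x (by simp)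
  have hx' := absLogHeight₁_ringHom (F := F) E.val.toRingHom x
  change absLogHeight₁ (x : F) = _ at hx'
  have hfr : (finrank ℚ E : ℝ) ≠ 0 := by exact_mod_cast finrank_pos.ne'
  have hlog : logHeight₁ x = 0 := by
    rw [h0, eq_comm, div_eq_zero_iff] at hx'
    exact hx'.resolve_right hfr
  -- Northcott: all powers of `x` have height zero, so two of them coincide.
  have hfin := finite_setOfPred_logHeight₁_le E 0
  have hmap : Set.MapsTo (fun n : ℕ ↦ x ^ n) Set.univ {y : E | logHeight₁ y ≤ 0} := fun n _ ↦ by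
    simp [logHeight₁_pow, hlog]
  obtain ⟨m, -, n, -, hmn, hpow⟩ := Set.infinite_univ.exists_ne_map_eq_of_mapsTo hmap hfin
  have hx0 : x ≠ 0 := fun h ↦ hx (by simp [h])
  wlog hlt : m < n generalizing m n
  · exact this n m hmn.symm hpow.symm (by omega)
  refine ⟨n - m, by omega, ?_⟩
  have : x ^ (n - m) = 1 := by
    rw [pow_sub₀ _ hx0 hlt.le]
    change x ^ m = x ^ n at hpow
    rw [hpow, mul_inv_cancel₀ (pow_ne_zero _ hx0)]
  exact_mod_cast congrArg (fun y : E ↦ (y : F)) this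

end Absolute

/-! ### Averaging in representations with finite orbits -/

namespace Representation

section Whole

variable {G V : Type*} [Group G] [AddCommGroup V] [Module ℚ V] (ρ : Representation ℚ G V)

/-- The subgroup of elements fixing a vector. -/
def stabilizerOf (v : V) : Subgroup G where
  carrier := {g | ρ g v = v}
  one_mem' := by simp
  mul_mem' {a b} ha hb := by
    simp only [Set.mem_ofPred_eq, map_mul, Module.End.mul_apply] at *
    rw [hb, ha]
  inv_mem' {a} ha := by
    simp only [Set.mem_ofPred_eq] at *
    conv_lhs => rw [← ha]
    rw [← Module.End.mul_apply, ← map_mul, inv_mul_cancel, map_one, Module.End.one_apply]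

lemma mem_stabilizerOf {g : G} {v : V} : g ∈ ρ.stabilizerOf v ↔ ρ g v = v := Iff.rfl

attribute [local instance] Subgroup.fintypeQuotientOfFiniteIndex

/-- Average over coset representatives of a finite-index normal subgroup. -/
noncomputable def cosetAverage (N : Subgroup G) [N.FiniteIndex] : V →ₗ[ℚ] V :=
  (N.index : ℚ)⁻¹ • ∑ q : G ⧸ N, ρ q.out

variable {ρ} {N : Subgroup G}

lemma apply_out (v : V) (hv : N ≤ ρ.stabilizerOf v) (g : G) :
    ρ (g : G ⧸ N).out v = ρ g v := by
  obtain ⟨n, hn⟩ := QuotientGroup.mk_out_eq_mul N g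
  rw [hn, map_mul, Module.End.mul_apply, ρ.mem_stabilizerOf.mp (hv n.2)]

variable [N.FiniteIndex]

lemma cosetAverage_apply (v : V) :
    ρ.cosetAverage N v = (N.index : ℚ)⁻¹ • ∑ q : G ⧸ N, ρ q.out v := by
  simp [cosetAverage, LinearMap.sum_apply]

lemma index_ne_zero_rat : (N.index : ℚ) ≠ 0 := by
  exact_mod_cast Subgroup.FiniteIndex.index_ne_zero

lemma cosetAverage_of_mem_invariants {v : V} (hv : v ∈ ρ.invariants) :
    ρ.cosetAverage N v = v := by
  rw [cosetAverage_apply, Finset.sum_congr rfl fun (q : G ⧸ N) _ ↦ hv q.out, Finset.sum_const,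
    Finset.card_univ, ← Nat.card_eq_fintype_card, ← Subgroup.index, ← Nat.cast_smul_eq_nsmul ℚ,
    smul_smul, inv_mul_cancel₀ index_ne_zero_rat, one_smul]

lemma cosetAverage_mem_invariants {v : V} (hv : N ≤ ρ.stabilizerOf v) :
    ρ.cosetAverage N v ∈ ρ.invariants := by
  intro g
  rw [cosetAverage_apply, map_smul, map_sum]
  congr 1
  refine Fintype.sum_equiv (MulAction.toPerm g) _ _ fun q ↦ ?_
  rw [← Module.End.mul_apply, ← map_mul, ← apply_out v hv (g * q.out)]
  congr 3
  rw [MulAction.toPerm_apply, ← smul_eq_mul, MulAction.Quotient.coe_smul_out]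

/-- Normality makes right translation by `g` a permutation of the cosets. -/
lemma cosetAverage_apply_eq [N.Normal] {v : V} (hv : N ≤ ρ.stabilizerOf v) (g : G) :
    ρ.cosetAverage N (ρ g v) = ρ.cosetAverage N v := by
  rw [cosetAverage_apply, cosetAverage_apply]
  congr 1
  refine Fintype.sum_equiv (Equiv.mulRight (g : G ⧸ N)) _ _ fun q ↦ ?_
  rw [← Module.End.mul_apply, ← map_mul, ← apply_out v hv (q.out * g)]
  congr 3
  simp

lemma sub_cosetAverage_mem_ker (v : V) : v - ρ.cosetAverage N v ∈ Coinvariants.ker ρ := by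
  have h : v - ρ.cosetAverage N v =
      -((N.index : ℚ)⁻¹ • ∑ q : G ⧸ N, (ρ q.out v - v)) := by
    rw [Finset.sum_sub_distrib, smul_sub, ← cosetAverage_apply, Finset.sum_const,
      Finset.card_univ, ← Nat.card_eq_fintype_card, ← Subgroup.index,
      ← Nat.cast_smul_eq_nsmul ℚ, smul_smul, inv_mul_cancel₀ index_ne_zero_rat, one_smul, neg_sub]
  rw [h]
  exact Submodule.neg_mem _ (Submodule.smul_mem _ _ (Submodule.sum_mem _ fun q _ ↦
    Coinvariants.sub_mem_ker _ _))

variable (ρ) in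
/-- If all stabilizers have finite index, the invariants are complementary to the
augmentation submodule. -/
lemma isCompl_invariants_ker (hfin : ∀ v, (ρ.stabilizerOf v).FiniteIndex) :
    IsCompl ρ.invariants (Coinvariants.ker ρ) := by
  refine IsCompl.of_eq ?_ ?_
  · rw [Submodule.eq_bot_iff]
    rintro v ⟨hv, hk⟩
    -- A vector of the augmentation submodule is a finite combination of differences `ρ g x - x`, so
    -- averages over all small enough normal subgroups kill it; averages fix invariant vectors.
    have key : ∀ w ∈ Coinvariants.ker ρ, ∃ N : Subgroup G, N.FiniteIndex ∧
        ∀ (N' : Subgroup G) [N'.FiniteIndex] [N'.Normal], N' ≤ N → ρ.cosetAverage N' w = 0 := by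
      intro w hw
      induction hw using Submodule.span_induction with
      | mem w hw =>
        obtain ⟨⟨g, x⟩, rfl⟩ := hw
        refine ⟨ρ.stabilizerOf x, hfin x, fun N' _ _ hN ↦ ?_⟩
        rw [map_sub, cosetAverage_apply_eq hN, sub_self]
      | zero => exact ⟨⊤, inferInstance, fun _ _ _ _ ↦ map_zero _⟩
      | add x y _ _ hx hy =>
        obtain ⟨A, hA, hA'⟩ := hx
        obtain ⟨B, hB, hB'⟩ := hy
        refine ⟨A ⊓ B, inferInstance, fun N' _ _ hN ↦ ?_⟩
        rw [map_add, hA' N' (hN.trans inf_le_left), hB' N' (hN.trans inf_le_right), add_zero]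
      | smul a x _ hx =>
        obtain ⟨A, hA, hA'⟩ := hx
        exact ⟨A, hA, fun N' _ _ hN ↦ by rw [map_smul, hA' N' hN, smul_zero]⟩
    obtain ⟨N, hN, h⟩ := key v hk
    rw [← cosetAverage_of_mem_invariants (N := N.normalCore) hv]
    exact h _ N.normalCore_le
  · rw [eq_top_iff]
    intro v _
    have := hfin v
    rw [← add_sub_cancel (ρ.cosetAverage (ρ.stabilizerOf v) v) v]
    exact Submodule.add_mem_sup (cosetAverage_mem_invariants le_rfl) (sub_cosetAverage_mem_ker v)

/-- Averages do not increase an invariant seminorm. -/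
lemma seminorm_cosetAverage_le (p : Seminorm ℚ V) (hp : ∀ g v, p (ρ g v) = p v) (v : V) :
    p (ρ.cosetAverage N v) ≤ p v := by
  have h1 : p (∑ q : G ⧸ N, ρ q.out v) ≤ N.index * p v := by
    refine (Finset.le_sum_of_subadditive p (map_zero p).le (map_add_le_add p) _ _).trans ?_
    simp only [hp, Finset.sum_const, Finset.card_univ, nsmul_eq_mul]
    rw [Subgroup.index, Nat.card_eq_fintype_card]
  have hpos : (0 : ℝ) < N.index := by
    exact_mod_cast Nat.pos_of_ne_zero Subgroup.FiniteIndex.index_ne_zero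
  rw [cosetAverage_apply, map_smul_eq_mul, norm_inv, ← Rat.norm_cast_real]
  simp only [Rat.cast_natCast, Real.norm_natCast]
  rw [inv_mul_le_iff₀ hpos]
  exact h1

end Whole

/-! ### Commuting projections onto invariants of subgroups -/

section Subgroups

variable {G V : Type*} [Group G] [AddCommGroup V] [Module ℚ V] (ρ : Representation ℚ G V)
  (hfin : ∀ v, (ρ.stabilizerOf v).FiniteIndex)

/-- The restriction of a representation to a subgroup. -/
abbrev restrict (H : Subgroup G) : Representation ℚ H V := ρ.comp H.subtype

include hfin in
lemma finiteIndex_stabilizerOf_restrict (H : Subgroup G) (v : V) :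
    ((ρ.restrict H).stabilizerOf v).FiniteIndex := by
  have := hfin v
  exact inferInstanceAs ((ρ.stabilizerOf v).subgroupOf H).FiniteIndex

/-- The projection onto the invariants of a subgroup. -/
noncomputable def invariantsProjection (H : Subgroup G) : V →ₗ[ℚ] V :=
  Submodule.projection _ _ ((ρ.restrict H).isCompl_invariants_ker
    (ρ.finiteIndex_stabilizerOf_restrict hfin H))

variable {ρ} {H : Subgroup G}

lemma invariantsProjection_mem (v : V) :
    ρ.invariantsProjection hfin H v ∈ (ρ.restrict H).invariants :=
  Submodule.projection_apply_mem _ _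

lemma invariantsProjection_of_mem {v : V} (hv : v ∈ (ρ.restrict H).invariants) :
    ρ.invariantsProjection hfin H v = v :=
  Submodule.projection_apply_left _ ⟨v, hv⟩

lemma sub_invariantsProjection_mem_ker (v : V) :
    v - ρ.invariantsProjection hfin H v ∈ Coinvariants.ker (ρ.restrict H) :=
  Submodule.sub_projection_mem _ _

lemma invariantsProjection_eq {v w : V} (hw : w ∈ (ρ.restrict H).invariants)
    (hvw : v - w ∈ Coinvariants.ker (ρ.restrict H)) :
    ρ.invariantsProjection hfin H v = w := by
  have h : ρ.invariantsProjection hfin H (v - w) = 0 :=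
    (Submodule.projection_apply_eq_zero_iff _).mpr hvw
  rw [map_sub, invariantsProjection_of_mem hfin hw, sub_eq_zero] at h
  exact h

/-- On each single vector the projection is the average over cosets of its stabilizer, though no one
average serves all vectors. -/
lemma seminorm_invariantsProjection_le (p : Seminorm ℚ V) (hp : ∀ g v, p (ρ g v) = p v) (v : V) :
    p (ρ.invariantsProjection hfin H v) ≤ p v := by
  have := ρ.finiteIndex_stabilizerOf_restrict hfin H v
  have h : ρ.invariantsProjection hfin H v =
      (ρ.restrict H).cosetAverage ((ρ.restrict H).stabilizerOf v) v :=
    invariantsProjection_eq hfin (cosetAverage_mem_invariants le_rfl) (sub_cosetAverage_mem_ker v)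
  rw [h]
  exact seminorm_cosetAverage_le (ρ := ρ.restrict H) p (fun g ↦ hp (g : G)) v

/-- A linear map preserving the invariants and the augmentation submodule commutes with the
projection. -/
lemma commute_invariantsProjection {f : V →ₗ[ℚ] V}
    (h1 : ∀ v ∈ (ρ.restrict H).invariants, f v ∈ (ρ.restrict H).invariants)
    (h2 : ∀ g ∈ H, ∀ v, f (ρ g v) - f v ∈ Coinvariants.ker (ρ.restrict H)) :
    Commute f (ρ.invariantsProjection hfin H) := by
  have h3 : Coinvariants.ker (ρ.restrict H) ≤ (Coinvariants.ker (ρ.restrict H)).comap f := by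
    refine Submodule.span_le.mpr ?_
    rintro _ ⟨⟨g, x⟩, rfl⟩
    simpa using h2 g g.2 x
  refine LinearMap.ext fun v ↦ ?_
  symm
  refine invariantsProjection_eq hfin (h1 _ (invariantsProjection_mem hfin v)) ?_
  rw [Module.End.mul_apply, ← map_sub]
  exact h3 (sub_invariantsProjection_mem_ker hfin v)

lemma commute_apply_invariantsProjection {g : G} (hg : g ∈ Subgroup.normalizer (H : Set G)) :
    Commute (ρ g) (ρ.invariantsProjection hfin H) := by
  refine commute_invariantsProjection hfin (fun v hv τ ↦ ?_) fun τ hτ v ↦ ?_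
  · have h := hv ⟨g⁻¹ * τ * g, (Subgroup.mem_normalizer_iff''.mp hg τ).mp τ.2⟩
    change ρ (g⁻¹ * τ * g) v = v at h
    change ρ τ (ρ g v) = ρ g v
    conv_rhs => rw [← h]
    rw [← Module.End.mul_apply, ← map_mul, ← Module.End.mul_apply, ← map_mul]
    group
  · have h := Coinvariants.sub_mem_ker (ρ := ρ.restrict H)
      ⟨g * τ * g⁻¹, (Subgroup.mem_normalizer_iff.mp hg τ).mp hτ⟩ (ρ g v)
    change ρ (g * τ * g⁻¹) (ρ g v) - ρ g v ∈ _ at h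
    rw [← Module.End.mul_apply, ← map_mul] at h ⊢
    simpa using h

/-- Elements of `L` commute with the projection for `H`, which therefore preserves both summands of
the decomposition for `L`. -/
lemma commute_invariantsProjection_of_le_normalizer {L : Subgroup G}
    (h : L ≤ Subgroup.normalizer (H : Set G)) :
    Commute (ρ.invariantsProjection hfin H) (ρ.invariantsProjection hfin L) := by
  have hc (g : G) (hg : g ∈ L) (v : V) : ρ.invariantsProjection hfin H (ρ g v) =
      ρ g (ρ.invariantsProjection hfin H v) :=
    (LinearMap.congr_fun (commute_apply_invariantsProjection hfin (h hg)) v).symm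
  refine commute_invariantsProjection hfin (fun v hv τ ↦ ?_) fun g hg v ↦ ?_
  · change ρ τ _ = _
    rw [← hc τ τ.2]
    exact congrArg _ (hv τ)
  · rw [hc g hg]
    exact Coinvariants.sub_mem_ker (ρ := ρ.restrict L) ⟨g, hg⟩ _

/-- The product of the complementary projections. -/
noncomputable def complProjection (l : List (Subgroup G)) : V →ₗ[ℚ] V :=
  (l.map fun H ↦ 1 - ρ.invariantsProjection hfin H).prod

lemma complProjection_cons (l : List (Subgroup G)) (v : V) :
    complProjection hfin (H :: l) v =
      complProjection hfin l v - ρ.invariantsProjection hfin H (complProjection hfin l v) := by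
  simp [complProjection]

/-- Each factor only subtracts an invariant vector; commutation is not needed here. -/
lemma sub_complProjection_mem (l : List (Subgroup G)) (v : V) :
    v - complProjection hfin l v ∈ ⨆ H ∈ l, (ρ.restrict H).invariants := by
  induction l with
  | nil => simp [complProjection]
  | cons H l ih =>
    rw [complProjection_cons, sub_sub_eq_add_sub, add_sub_right_comm]
    refine Submodule.add_mem _ (SetLike.le_def.mp ?_ ih) (Submodule.mem_iSup_of_mem H
      (Submodule.mem_iSup_of_mem List.mem_cons_self (invariantsProjection_mem hfin _)))
    exact iSup_mono fun K ↦ iSup_le fun hK ↦ le_iSup_of_le (List.mem_cons_of_mem _ hK) le_rfl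

lemma seminorm_complProjection_le (p : Seminorm ℚ V) (hp : ∀ g v, p (ρ g v) = p v)
    (l : List (Subgroup G)) (v : V) : p (complProjection hfin l v) ≤ 2 ^ l.length * p v := by
  induction l with
  | nil => simp [complProjection]
  | cons H l ih =>
    rw [complProjection_cons, List.length_cons, pow_succ]
    have h1 := map_sub_le_add p (complProjection hfin l v)
      (ρ.invariantsProjection hfin H (complProjection hfin l v))
    have h2 := seminorm_invariantsProjection_le hfin p hp (H := H) (complProjection hfin l v)
    linarith

lemma complProjection_eq_zero {l : List (Subgroup G)}
    (hl : ∀ H ∈ l, ∀ L ∈ l, H ≤ Subgroup.normalizer (L : Set G) ∨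
      L ≤ Subgroup.normalizer (H : Set G))
    {v : V} (hv : v ∈ ⨆ H ∈ l, (ρ.restrict H).invariants) : complProjection hfin l v = 0 := by
  have hcomm : ∀ H ∈ l, ∀ L ∈ l, Commute (ρ.invariantsProjection hfin H)
      (ρ.invariantsProjection hfin L) := fun H hH L hL ↦ (hl H hH L hL).elim
    (fun h ↦ (commute_invariantsProjection_of_le_normalizer hfin h).symm)
    (commute_invariantsProjection_of_le_normalizer hfin)
  suffices (⨆ H ∈ l, (ρ.restrict H).invariants) ≤ LinearMap.ker (complProjection hfin l) from
    this hv
  refine iSup₂_le fun H hH v hv ↦ ?_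
  have hprod : ∀ l' : List (Subgroup G), l' ⊆ l → H ∈ l' → complProjection hfin l' v = 0 := by
    intro l' hl' hmem
    induction l' with
    | nil => simp at hmem
    | cons L l' ih =>
      have hl'' : l' ⊆ l := fun x hx ↦ hl' (List.mem_cons_of_mem _ hx)
      rcases List.mem_cons.mp hmem with rfl | hmem
      -- Commutation lets the factor for `H` act first, where it kills `v`.
      · have hc : Commute (ρ.invariantsProjection hfin H) (complProjection hfin l') := by
          refine Commute.list_prod_right _ _ fun f hf ↦ ?_
          obtain ⟨L, hL, rfl⟩ := List.mem_map.mp hf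
          exact (Commute.one_right _).sub_right (hcomm _ hH _ (hl'' hL))
        have h := LinearMap.congr_fun hc v
        simp only [Module.End.mul_apply, invariantsProjection_of_mem hfin hv] at h
        rw [complProjection_cons, h, sub_self]
      · rw [complProjection_cons, ih hl'' hmem, map_zero, sub_zero]
  exact hprod l (List.Subset.refl l) hH

end Subgroups

/-- A vector in the closure of a sum of spaces of invariants of pairwise normalizing subgroups is
in the sum, up to a vector of seminorm zero. -/
theorem exists_mem_iSup_invariants_seminorm_sub_eq_zero {G V : Type*} [Group G] [AddCommGroup V]
    [Module ℚ V] {ρ : Representation ℚ G V} (hfin : ∀ v, (ρ.stabilizerOf v).FiniteIndex)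
    {p : Seminorm ℚ V} (hp : ∀ g v, p (ρ g v) = p v) {ι : Type*} [Fintype ι]
    {H : ι → Subgroup G} (hH : ∀ i j, i ≠ j → H i ≤ Subgroup.normalizer (H j : Set G) ∨
      H j ≤ Subgroup.normalizer (H i : Set G))
    {v : V} (hv : ∀ ε : ℝ, 0 < ε → ∃ w ∈ ⨆ i, (ρ.restrict (H i)).invariants, p (v - w) < ε) :
    ∃ w ∈ ⨆ i, (ρ.restrict (H i)).invariants, p (v - w) = 0 := by
  set l : List (Subgroup G) := (Finset.univ.toList).map H with hl
  have hsup : ⨆ L ∈ l, (ρ.restrict L).invariants = ⨆ i, (ρ.restrict (H i)).invariants := by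
    refine le_antisymm (iSup₂_le fun L hL ↦ ?_) (iSup_le fun i ↦ ?_)
    · obtain ⟨i, -, rfl⟩ := List.mem_map.mp hL
      exact le_iSup (fun i ↦ (ρ.restrict (H i)).invariants) i
    · exact le_iSup₂_of_le (H i) (List.mem_map.mpr ⟨i, by simp, rfl⟩) le_rfl
  have hn : ∀ A ∈ l, ∀ B ∈ l, A ≤ Subgroup.normalizer (B : Set G) ∨
      B ≤ Subgroup.normalizer (A : Set G) := by
    intro A hA B hB
    obtain ⟨i, -, rfl⟩ := List.mem_map.mp hA
    obtain ⟨j, -, rfl⟩ := List.mem_map.mp hB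
    by_cases hij : i = j
    · subst hij; exact .inl Subgroup.le_normalizer
    · exact hH i j hij
  rw [← hsup] at hv ⊢
  refine ⟨v - complProjection hfin l v, sub_complProjection_mem hfin l v, ?_⟩
  rw [sub_sub_cancel]
  refine le_antisymm (le_of_forall_pos_le_add fun ε hε ↦ ?_) (apply_nonneg p _)
  -- The denominator offsets the norm bound for the product of complementary projections.
  obtain ⟨w, hw, hvw⟩ := hv (ε / 2 ^ l.length) (by positivity)
  have h1 : complProjection hfin l v = complProjection hfin l (v - w) := by
    rw [map_sub, complProjection_eq_zero hfin hn hw, sub_zero]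
  rw [h1, zero_add]
  refine (seminorm_complProjection_le hfin p hp l (v - w)).trans ?_
  rw [lt_div_iff₀ (by positivity)] at hvw
  linarith

end Representation

/-! ### Denominators and the divisible hull -/

namespace AddMonoidHom

variable {A V ι : Type*} [AddCommGroup A] [AddCommGroup V] [Fintype ι] (c : A →+ V)

lemma sub_sum_inv_smul_eq [Module ℚ V] {m : ℤ} (hm : m ≠ 0) (a : A) (b : ι → A) :
    c a - ∑ i, (m : ℚ)⁻¹ • c (b i) = (m : ℚ)⁻¹ • c (m • a - ∑ i, b i) := by
  have hm' : (m : ℚ) ≠ 0 := by exact_mod_cast hm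
  rw [map_sub, map_zsmul, map_sum, smul_sub, ← Int.cast_smul_eq_zsmul ℚ, smul_smul,
    inv_mul_cancel₀ hm', one_smul, Finset.smul_sum]

lemma map_prod_nsmul_eq [DecidableEq ι] {a : A} {w : ι → V} {t : ι → ℕ} {g : ι → A}
    (ha : c a = ∑ i, w i) (hw : ∀ i, t i • w i = c (g i)) :
    c ((∏ i, t i) • a) = c (∑ i, (∏ k ∈ Finset.univ.erase i, t k) • g i) := by
  rw [map_nsmul, ha, map_sum, Finset.smul_sum]
  refine Finset.sum_congr rfl fun i hi ↦ ?_
  rw [map_nsmul, ← hw, smul_smul, Finset.prod_erase_mul _ _ hi]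

end AddMonoidHom

namespace DivisibleHull

variable {M : Type*} [AddCommGroup M]

lemma mk_smul_left (u : ℕ+) (x : M) (s : ℕ+) : mk ((u : ℕ) • x) (u * s) = mk x s := by
  rw [mk_eq_mk]
  exact ⟨1, by simp [smul_smul, mul_comm]⟩

lemma mk_eq_smul (x : M) (s : ℕ+) : mk x s = (s : ℚ)⁻¹ • mk x 1 := by
  have h : (s : ℚ) • mk x s = mk x 1 := by
    rw [Nat.cast_smul_eq_nsmul, nsmul_mk]
    simpa using mk_smul_left s x 1
  rw [← h, smul_smul, inv_mul_cancel₀ (by exact_mod_cast s.ne_zero), one_smul]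

lemma coe_eq_zero_iff {x : M} : mk x 1 = 0 ↔ ∃ u : ℕ+, (u : ℕ) • x = 0 := by
  rw [← mk_zero 1, mk_eq_mk]
  simp

/-- Functoriality of the divisible hull. -/
noncomputable def map (f : M →+ M) : DivisibleHull M →ₗ[ℚ] DivisibleHull M :=
  AddMonoidHom.toRatLinearMap
    { toFun := fun v ↦ liftOn v (fun x s ↦ mk (f x) s) fun x x' s s' h ↦ by
        rw [mk_eq_mk] at h ⊢
        obtain ⟨u, hu⟩ := h
        exact ⟨u, by simpa using congrArg f hu⟩
      map_zero' := by
        rw [← mk_zero 1, liftOn_mk, map_zero]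
      map_add' := fun v w ↦ by
        induction v with | mk x s
        induction w with | mk y t
        simp [mk_add_mk] }

/-- An action on a group induces a representation on its divisible hull. -/
noncomputable def representation {G : Type*} [Group G] (a : G →* AddMonoid.End M) :
    Representation ℚ G (DivisibleHull M) where
  toFun g := map (a g)
  map_one' := by
    ext v
    induction v with | mk x s
    rw [map_one]
    rfl
  map_mul' g h := by
    ext v
    induction v with | mk x s
    rw [map_mul]
    rfl

@[simp]
lemma representation_mk {G : Type*} [Group G] (a : G →* AddMonoid.End M) (g : G) (x : M)
    (s : ℕ+) : representation a g (mk x s) = mk (a g x) s := rfl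

/-- A subadditive homogeneous function extends to a seminorm on the divisible hull. -/
noncomputable def seminorm (h : M → ℝ) (hadd : ∀ x y, h (x + y) ≤ h x + h y)
    (hsmul : ∀ (n : ℤ) x, h (n • x) = |(n : ℝ)| * h x) : Seminorm ℚ (DivisibleHull M) :=
  have hn (n : ℕ) (x : M) : h (n • x) = n * h x := by simpa using hsmul n x
  Seminorm.of
    (fun v ↦ liftOn v (fun x s ↦ h x / s) fun x x' s s' e ↦ by
      obtain ⟨u, hu⟩ := mk_eq_mk.mp e
      have := congrArg h hu
      simp only [hn] at this
      have hu0 : ((u.val : ℕ) : ℝ) ≠ 0 := by exact_mod_cast u.ne_zero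
      have hs0 : ((s.val : ℕ) : ℝ) ≠ 0 := by exact_mod_cast s.ne_zero
      have hs0' : ((s'.val : ℕ) : ℝ) ≠ 0 := by exact_mod_cast s'.ne_zero
      have h2 := mul_left_cancel₀ hu0 this
      rw [div_eq_div_iff hs0 hs0', mul_comm, h2, mul_comm])
    (fun v w ↦ by
      induction v with | mk x s
      induction w with | mk y t
      rw [mk_add_mk, liftOn_mk, liftOn_mk, liftOn_mk]
      have hs : (0 : ℝ) < (s.val : ℕ) := by exact_mod_cast s.pos
      have ht : (0 : ℝ) < (t.val : ℕ) := by exact_mod_cast t.pos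
      rw [div_add_div _ _ hs.ne' ht.ne', PNat.mul_coe, Nat.cast_mul]
      gcongr
      refine (hadd _ _).trans_eq ?_
      rw [hn, hn]
      ring)
    (fun a v ↦ by
      induction v with | mk x s
      rw [qsmul_mk, liftOn_mk, liftOn_mk, hsmul, ← Rat.norm_cast_real, Real.norm_eq_abs]
      change |(a.num : ℝ)| * h x / ((a.den * s.val : ℕ) : ℝ) = _
      conv_rhs => rw [← Rat.num_div_den a]
      push_cast
      rw [abs_div, Nat.abs_cast, div_mul_div_comm])

lemma sub_sum_inv_smul_coe {ι : Type*} [Fintype ι] {m : ℤ} (hm : m ≠ 0) (a : M) (b : ι → M) :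
    mk a 1 - ∑ i, (m : ℚ)⁻¹ • mk (b i) 1 = (m : ℚ)⁻¹ • mk (m • a - ∑ i, b i) 1 :=
  AddMonoidHom.sub_sum_inv_smul_eq (V := DivisibleHull M) (coeAddMonoidHom M) hm a b

lemma coe_prod_nsmul_eq {ι : Type*} [Fintype ι] [DecidableEq ι] {a : M} {w : ι → DivisibleHull M}
    {t : ι → ℕ} {g : ι → M} (ha : mk a 1 = ∑ i, w i) (hw : ∀ i, t i • w i = mk (g i) 1) :
    mk ((∏ i, t i) • a) 1 = mk (∑ i, (∏ k ∈ Finset.univ.erase i, t k) • g i) 1 :=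
  AddMonoidHom.map_prod_nsmul_eq (V := DivisibleHull M) (coeAddMonoidHom M) ha hw

end DivisibleHull

lemma additive_units_ext {F : Type*} [Monoid F] {x y : Additive Fˣ}
    (h : (x.toMul : F) = y.toMul) : x = y :=
  Additive.toMul.injective (Units.ext h)

/-! ### The Galois action on the multiplicative group -/

section Galois

variable {F : Type*} [Field F] [CharZero F]

lemma le_normalizer_fixingSubgroup {S : Subgroup Gal(F/ℚ)} {K : IntermediateField ℚ F}
    (h : ∀ σ ∈ S, ∀ x ∈ K, σ x ∈ K) :
    S ≤ Subgroup.normalizer (K.fixingSubgroup : Set Gal(F/ℚ)) := by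
  intro σ hσ
  rw [Subgroup.mem_normalizer_iff]
  intro τ
  simp only [IntermediateField.mem_fixingSubgroup_iff, AlgEquiv.mul_apply]
  refine ⟨fun hτ x hx ↦ ?_, fun hτ x hx ↦ ?_⟩
  · rw [hτ _ (h _ (S.inv_mem hσ) x hx), ← AlgEquiv.mul_apply, mul_inv_cancel, AlgEquiv.one_apply]
  · have := hτ _ (h σ hσ x hx)
    rw [← AlgEquiv.mul_apply σ⁻¹, inv_mul_cancel, AlgEquiv.one_apply] at this
    exact σ.injective this

/-- An automorphism fixing `L` fixes `E`, hence maps the normal extension `K` of `E` into itself. -/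
lemma fixingSubgroup_le_normalizer_of_normal [Normal ℚ F] {E K L : IntermediateField ℚ F}
    (hEK : E ≤ K) (hEL : E ≤ L) (hn : Normal E (IntermediateField.extendScalars hEK)) :
    L.fixingSubgroup ≤ Subgroup.normalizer (K.fixingSubgroup : Set Gal(F/ℚ)) := by
  refine le_normalizer_fixingSubgroup fun σ hσ x hx ↦ ?_
  have : Normal E F := Normal.tower_top_of_normal ℚ E F
  let σ' : Gal(F/E) := E.fixingSubgroupEquiv ⟨σ, IntermediateField.fixingSubgroup_antitone hEL hσ⟩
  exact IntermediateField.normal_iff_forall_map_le'.mp hn σ' ⟨x, hx, rfl⟩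

variable (F) in
/-- The Galois action on the multiplicative group, written additively. -/
def galoisUnitsAction : Gal(F/ℚ) →* AddMonoid.End (Additive Fˣ) where
  toFun σ := (Units.map (σ : F →* F)).toAdditive
  map_one' := rfl
  map_mul' _ _ := rfl

lemma galoisUnitsAction_apply (σ : Gal(F/ℚ)) (x : Additive Fˣ) :
    ((galoisUnitsAction F σ x).toMul : F) = σ (x.toMul : F) := rfl

variable (F) in
/-- The Galois representation on the divisible hull of the multiplicative group. -/
noncomputable abbrev galoisUnitsRepresentation :
    Representation ℚ Gal(F/ℚ) (DivisibleHull (Additive Fˣ)) :=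
  DivisibleHull.representation (galoisUnitsAction F)

lemma mk_mem_invariants {K : IntermediateField ℚ F} {x : Additive Fˣ} (hx : (x.toMul : F) ∈ K)
    (s : ℕ+) : DivisibleHull.mk x s ∈
      ((galoisUnitsRepresentation F).restrict K.fixingSubgroup).invariants := by
  intro σ
  change DivisibleHull.mk (galoisUnitsAction F σ x) s = _
  congr 1
  exact additive_units_ext (σ.2 ⟨_, hx⟩)

variable [IsGalois ℚ F]

lemma finiteIndex_stabilizerOf_galoisUnits (v : DivisibleHull (Additive Fˣ)) :
    ((galoisUnitsRepresentation F).stabilizerOf v).FiniteIndex := by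
  induction v with | mk x s
  set E := IntermediateField.adjoin ℚ {(x.toMul : F)}
  have hfd : FiniteDimensional ℚ E :=
    IntermediateField.adjoin.finiteDimensional (Algebra.IsIntegral.isIntegral _)
  have : E.fixingSubgroup.FiniteIndex := ⟨by
    rw [← IntermediateField.finrank_eq_fixingSubgroup_index]
    exact Module.finrank_pos.ne'⟩
  refine Subgroup.finiteIndex_of_le (H := E.fixingSubgroup) fun σ hσ ↦ ?_
  rw [Representation.mem_stabilizerOf, DivisibleHull.representation_mk]
  congr 1
  exact additive_units_ext (hσ ⟨_, IntermediateField.mem_adjoin_simple_self ℚ _⟩)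

/-- If every conjugate of `x` over `K` differs from `x` by torsion, a power of `x` lies in `K`. -/
lemma exists_pow_mem_of_forall_exists_pow_eq {K : IntermediateField ℚ F} {x : F}
    (h : ∀ σ ∈ K.fixingSubgroup, ∃ u : ℕ, u ≠ 0 ∧ σ x ^ u = x ^ u) :
    ∃ n : ℕ, n ≠ 0 ∧ x ^ n ∈ K := by
  classical
  have hfin : {y | ∃ σ ∈ K.fixingSubgroup, σ x = y}.Finite := by
    refine ((minpoly ℚ x).rootSet_finite F).subset ?_
    rintro _ ⟨σ, -, rfl⟩
    rw [Polynomial.mem_rootSet]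
    refine ⟨minpoly.ne_zero (Algebra.IsIntegral.isIntegral x), ?_⟩
    rw [Polynomial.aeval_algHom_apply, minpoly.aeval, map_zero]
  have h' : ∀ y ∈ hfin.toFinset, ∃ u : ℕ, u ≠ 0 ∧ y ^ u = x ^ u := fun y hy ↦ by
    obtain ⟨σ, hσ, rfl⟩ := hfin.mem_toFinset.mp hy
    exact h σ hσ
  choose! u hu0 hu using h'
  -- There are finitely many conjugates, so the product of their exponents serves all of them at
  -- once; infinite Galois theory then puts the power in `K`.
  refine ⟨∏ y ∈ hfin.toFinset, u y, Finset.prod_ne_zero_iff.mpr hu0, ?_⟩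
  refine (InfiniteGalois.fixedField_fixingSubgroup K).le ?_
  rintro ⟨σ, hσ⟩
  change σ _ = _
  have hmem : σ x ∈ hfin.toFinset := hfin.mem_toFinset.mpr ⟨σ, hσ, rfl⟩
  rw [map_pow, ← Finset.mul_prod_erase _ _ hmem, pow_mul, hu _ hmem, ← pow_mul]

/-- Invariance in the hull means that conjugates over `K` agree only up to torsion, which a suitable
power removes. -/
lemma exists_eq_smul_of_mem_invariants {K : IntermediateField ℚ F}
    {v : DivisibleHull (Additive Fˣ)}
    (hv : v ∈ ((galoisUnitsRepresentation F).restrict K.fixingSubgroup).invariants) :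
    ∃ (n : ℕ) (γ : Kˣ), n ≠ 0 ∧
      n • v = DivisibleHull.mk (.ofMul (Units.map K.val.toMonoidHom γ)) 1 := by
  induction v with | mk x s
  obtain ⟨n, hn, hmem⟩ := exists_pow_mem_of_forall_exists_pow_eq (K := K) (x := (x.toMul : F))
    fun σ hσ ↦ by
      have h : DivisibleHull.mk (galoisUnitsAction F σ x) s = DivisibleHull.mk x s := hv ⟨σ, hσ⟩
      obtain ⟨u, hu⟩ := DivisibleHull.mk_eq_mk.mp h
      refine ⟨u * s, mul_ne_zero u.ne_zero s.ne_zero, ?_⟩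
      have h1 := congrArg (fun y : Additive Fˣ ↦ (y.toMul : F)) hu
      simp only [smul_smul, toMul_nsmul, Units.val_pow_eq_pow_val, galoisUnitsAction_apply] at h1
      exact h1
  have hne : (⟨_, hmem⟩ : K) ≠ 0 := fun h ↦
    pow_ne_zero n x.toMul.ne_zero (congrArg Subtype.val h)
  refine ⟨s * n, Units.mk0 _ hne, mul_ne_zero s.ne_zero hn, ?_⟩
  rw [DivisibleHull.nsmul_mk, mul_smul]
  have := DivisibleHull.mk_smul_left s (n • x) 1
  rw [mul_one] at this
  rw [this]
  exact congrArg (DivisibleHull.mk · 1) (additive_units_ext (by simp))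

end Galois

/-! ### The height as a Galois-invariant norm -/

section Height

variable {F : Type*} [Field F] [CharZero F] [Algebra.IsAlgebraic ℚ F]

variable (F) in
/-- The height as a seminorm on the divisible hull of the multiplicative group. -/
noncomputable def heightSeminorm : Seminorm ℚ (DivisibleHull (Additive Fˣ)) :=
  DivisibleHull.seminorm (fun x ↦ absLogHeight₁ (x.toMul : F))
    (fun x y ↦ by simpa using absLogHeight₁_mul_le (x.toMul : F) y.toMul)
    (fun n x ↦ by simpa using absLogHeight₁_zpow (x.toMul : F) n)

lemma heightSeminorm_mk (x : Additive Fˣ) (s : ℕ+) :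
    heightSeminorm F (.mk x s) = absLogHeight₁ (x.toMul : F) / s := rfl

lemma heightSeminorm_representation (σ : Gal(F/ℚ)) (v : DivisibleHull (Additive Fˣ)) :
    heightSeminorm F (galoisUnitsRepresentation F σ v) = heightSeminorm F v := by
  induction v with | mk x s
  rw [DivisibleHull.representation_mk, heightSeminorm_mk, heightSeminorm_mk,
    galoisUnitsAction_apply]
  congr 1
  exact absLogHeight₁_map (σ : F →+* F) _

lemma eq_zero_of_heightSeminorm_eq_zero {v : DivisibleHull (Additive Fˣ)}
    (hv : heightSeminorm F v = 0) : v = 0 := by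
  induction v with | mk x s
  rw [heightSeminorm_mk, div_eq_zero_iff, or_iff_left (by exact_mod_cast s.ne_zero)] at hv
  obtain ⟨n, hn, hpow⟩ := exists_pow_eq_one_of_absLogHeight₁_eq_zero x.toMul.ne_zero hv
  rw [DivisibleHull.mk_eq_smul, DivisibleHull.coe_eq_zero_iff.mpr, smul_zero]
  refine ⟨⟨n, Nat.pos_of_ne_zero hn⟩, additive_units_ext ?_⟩
  simpa using hpow

end Height

/-! ### Conclusion -/

theorem corollary1p4
    {Qbar : Type*} [Field Qbar] [CharZero Qbar] [IsAlgClosure ℚ Qbar]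
    (N : ℕ) (K : Fin N → IntermediateField ℚ Qbar)
    (hK : ∀ i j : Fin N, i ≠ j →
      IsGalois ↥(K i ⊓ K j)
          ↥(IntermediateField.extendScalars (inf_le_left : K i ⊓ K j ≤ K i)) ∨
        IsGalois ↥(K i ⊓ K j)
          ↥(IntermediateField.extendScalars (inf_le_right : K i ⊓ K j ≤ K j)))
    (α : Qbar) (hα : α ≠ 0)
    (happrox : ∀ ε : ℝ, 0 < ε → ∃ m : ℤ, m ≠ 0 ∧ ∃ β : (n : Fin N) → (K n)ˣ,
      NumberField.absLogHeight₁ (α ^ m * ∏ n, (((β n : K n) : Qbar))⁻¹) < ε * |(m : ℝ)|) :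
    ∃ q : ℤ, q ≠ 0 ∧ ∃ γ : (n : Fin N) → (K n)ˣ, α ^ q = ∏ n, ((γ n : K n) : Qbar) := by
  have : Algebra.IsAlgebraic ℚ Qbar := IsAlgClosure.isAlgebraic
  have : IsGalois ℚ Qbar := inferInstance
  let c (x : Additive Qbarˣ) : DivisibleHull (Additive Qbarˣ) := .mk x 1
  let a : Additive Qbarˣ := .ofMul (Units.mk0 α hα)
  let u (n : Fin N) (γ : (K n)ˣ) : Additive Qbarˣ := .ofMul (Units.map (K n).val.toMonoidHom γ)
  have hc (x : Additive Qbarˣ) : heightSeminorm Qbar (c x) = absLogHeight₁ (x.toMul : Qbar) := by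
    simp [c, heightSeminorm_mk]
  obtain ⟨w, hw, hw0⟩ := Representation.exists_mem_iSup_invariants_seminorm_sub_eq_zero
    (finiteIndex_stabilizerOf_galoisUnits (F := Qbar)) heightSeminorm_representation
    (H := fun n ↦ (K n).fixingSubgroup)
    (fun i j hij ↦ (hK i j hij).symm.imp
      (fun h ↦ fixingSubgroup_le_normalizer_of_normal inf_le_right inf_le_left h.to_normal)
      (fun h ↦ fixingSubgroup_le_normalizer_of_normal inf_le_left inf_le_right h.to_normal))
    (v := c a) fun ε hε ↦ by
      obtain ⟨m, hm, β, hβ⟩ := happrox ε hε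
      -- Dividing by `m` in the hull turns the hypothesis into distance less than `ε`.
      refine ⟨∑ n, (m : ℚ)⁻¹ • c (u n (β n)), Submodule.sum_mem _ fun n _ ↦
        Submodule.smul_mem _ _ (Submodule.mem_iSup_of_mem n (mk_mem_invariants
          (β n : K n).2 1)), ?_⟩
      have hpos : (0 : ℝ) < |(m : ℝ)| := by positivity
      have h1 : heightSeminorm Qbar (c a - ∑ n, (m : ℚ)⁻¹ • c (u n (β n))) =
          ‖(m : ℚ)⁻¹‖ * absLogHeight₁ (α ^ m * ∏ n, (((β n : K n) : Qbar))⁻¹) := by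
        rw [DivisibleHull.sub_sum_inv_smul_coe hm, map_smul_eq_mul, hc]
        congr 2
        simp [a, u, div_eq_mul_inv]
      rw [h1, norm_inv, ← Rat.norm_cast_real, Rat.cast_intCast, Real.norm_eq_abs,
        inv_mul_lt_iff₀ hpos, mul_comm |(m : ℝ)|]
      exact hβ
  have hαw := sub_eq_zero.mp (eq_zero_of_heightSeminorm_eq_zero hw0)
  obtain ⟨w', hw', hsum⟩ := (Submodule.mem_iSup_iff_exists_finsupp _ _).mp hw
  choose t γ ht hγ using fun n ↦ exists_eq_smul_of_mem_invariants (hw' n)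
  rw [← hsum, Finsupp.sum_fintype _ _ (fun _ ↦ rfl)] at hαw
  -- Equality in the hull holds in the group only after multiplying by some `r`, which joins the
  -- exponent.
  obtain ⟨r, hr⟩ := DivisibleHull.mk_eq_mk.mp
    (DivisibleHull.coe_prod_nsmul_eq (g := fun n ↦ u n (γ n)) hαw hγ)
  have hr' := congrArg (fun y : Additive Qbarˣ ↦ (y.toMul : Qbar)) hr
  simp only [PNat.val_ofNat, one_smul, toMul_nsmul, toMul_sum, a, u, toMul_ofMul,
    Units.val_pow_eq_pow_val, Units.val_mk0, Units.coe_prod, ← Finset.prod_pow] at hr'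
  refine ⟨((∏ n, t n : ℕ) : ℤ) * (r : ℕ), mul_ne_zero
    (by exact_mod_cast Finset.prod_ne_zero_iff.mpr fun n _ ↦ ht n)
    (by exact_mod_cast r.ne_zero),
    fun n ↦ γ n ^ ((∏ k ∈ Finset.univ.erase n, t k) * (r : ℕ)), ?_⟩
  rw [zpow_mul, zpow_natCast, zpow_natCast, hr']
  refine Finset.prod_congr rfl fun n _ ↦ ?_
  simp [pow_mul]
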